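/- Work in ZFC. For an uncountable cardinal $\mu$, a $\mu$-complete ultrafilter $U$ over $\mu$ (one closed under intersections of fewer than $\mu$ of its members) is called non-Galvin if there is a family of $\mu^+$ many sets in $U$ such that no subfamily of size $\mu$ has its intersection in $U$. (Such an ultrafilter is automatically nonprincipal.) A cardinal $\kappa$ is $\lambda$-supercompact if there is an elementary embedding $j:V\to M$ into a transitive class $M$ with critical point $\kappa$ and $M^{\lambda}\subseteq M$, and supercompact if it is $\lambda$-supercompact for every cardinal $\lambda\ge\kappa$. Proposition. Suppose that there is a supercompact cardinal, and let $\kappa$ be the least one. Then there is an uncountable cardinal $\mu$ that carries a non-Galvin $\mu$-complete ultrafilter over $\mu$, and the least such $\mu$ is strictly below $\kappa$. -/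

import Mathlib

universe u

open Cardinal Set FirstOrder

/-- The relation symbols of the language of set theory: one binary symbol. -/
inductive SetTheoryRel : ℕ → Type
  | mem : SetTheoryRel 2

/-- The first-order language of set theory, with a single binary relation symbol. -/
def setLanguage : FirstOrder.Language.{0, 0} := ⟨fun _ => Empty, SetTheoryRel⟩

/-- The universe `(V, ∈)`. -/
instance universeStructure : setLanguage.Structure ZFSet.{u} where
  funMap := fun f => Empty.elim f
  RelMap := fun {_} r => match r with
    | SetTheoryRel.mem => fun x => x 0 ∈ x 1

/-- A class `M` of sets, with the true membership relation, `(M, ∈)`. -/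
instance classStructure (M : Set ZFSet.{u}) : setLanguage.Structure M where
  funMap := fun f => Empty.elim f
  RelMap := fun {_} r => match r with
    | SetTheoryRel.mem => fun x => (x 0 : ZFSet.{u}) ∈ (x 1 : ZFSet.{u})

/-- `M` is a transitive class. -/
def IsTransitiveClass (M : Set ZFSet.{u}) : Prop :=
  ∀ x ∈ M, ∀ y ∈ x, y ∈ M

/-- `M ^ lam ⊆ M`: every function from (the initial ordinal of) `lam` to a subset of `M` is an
element of `M`. -/
def ClosedUnderSequences (M : Set ZFSet.{u}) (lam : Cardinal.{u}) : Prop :=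
  ∀ y f : ZFSet.{u}, (∀ z ∈ y, z ∈ M) → ZFSet.IsFunc lam.ord.toZFSet y f → f ∈ M

/-- The critical point of `j : V → M` is the ordinal `α`: it is the least ordinal moved by `j`. -/
def IsCriticalPoint {M : Set ZFSet.{u}} (j : ZFSet.{u} ↪ₑ[setLanguage] M)
    (α : Ordinal.{u}) : Prop :=
  IsLeast {β : Ordinal.{u} | (j β.toZFSet : ZFSet.{u}) ≠ β.toZFSet} α

/-- `κ` is `lam`-supercompact: there is an elementary embedding `j : V → M` into a transitive class
`M` with critical point `κ` and `M ^ lam ⊆ M`. -/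
def IsSupercompactUpTo (κ lam : Cardinal.{u}) : Prop :=
  ∃ (M : Set ZFSet.{u}) (j : ZFSet.{u} ↪ₑ[setLanguage] M),
    IsTransitiveClass M ∧ IsCriticalPoint j κ.ord ∧ ClosedUnderSequences M lam

/-- `κ` is supercompact: it is `lam`-supercompact for every cardinal `lam ≥ κ`. -/
def IsSupercompact (κ : Cardinal.{u}) : Prop :=
  ∀ lam : Cardinal.{u}, κ ≤ lam → IsSupercompactUpTo κ lam

/-- The Galvin property `Gal(F, κ, κ⁺)`: every family of `κ⁺` many members of `F` has a subfamily
of size `κ` whose intersection belongs to `F`. -/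
def HasGalvinProperty {X : Type u} (F : Filter X) (κ : Cardinal.{u}) : Prop :=
  ∀ A : Set (Set X), (∀ s ∈ A, s ∈ F) → #A = Order.succ κ →
    ∃ B : Set (Set X), B ⊆ A ∧ #B = κ ∧ ⋂₀ B ∈ F

/-- `κ` is uncountable and carries a `κ`-complete ultrafilter that fails the Galvin property.
Such an ultrafilter is nonprincipal, since a principal ultrafilter has the Galvin property. -/
def CarriesNonGalvinUltrafilter (κ : Cardinal.{u}) : Prop :=
  ℵ₀ < κ ∧ ∃ U : Ultrafilter κ.ord.ToType,
    CardinalInterFilter (U : Filter κ.ord.ToType) κ ∧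
      ¬ HasGalvinProperty (U : Filter κ.ord.ToType) κ

/-! Let `j : V → M` have critical point `κ`, with `M` closed under `2 ^ κ`-sequences. Then `κ` is
inaccessible, and a family `B` of subsets of `κ` whose subfamilies of size less than `κ` have
nonempty intersection extends to a `κ`-complete ultrafilter: the pointwise image `j '' B` lies in
`M`, elementarity gives a point `z ∈ j κ` common to all its members, and `{s | z ∈ j s}` is the
ultrafilter (`exists_ultrafilter_superset`).

Apply this to a `κ`-independent family of `2 ^ κ` sets together with the complements of all
intersections of `κ` of its members. The resulting ultrafilter contains the whole family but no
intersection of `κ` of its members, so it is non-Galvin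
(`carriesNonGalvinUltrafilter_of_extension`).

By closure, `M` recognizes this ultrafilter, and `κ < j κ`. So `M` sees a non-Galvin ultrafilter
over some element of `j κ`, and by elementarity `V` has one over some element of `κ`. Cardinals are
well-ordered, so a least example exists.

Elementarity is applied through `IsExpressible` and `elementary_iff`: each transferred property is
built from closure lemmas, with unbounded quantifiers relativized to the class. -/

open FirstOrder.Language in
/-- A predicate, relative to a class `C`, that is expressed by one formula of set theory in the
universe and in every transitive class `C`. -/
def IsExpressible {n : ℕ} (P : Set ZFSet.{u} → (Fin n → ZFSet.{u}) → Prop) : Prop :=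
  ∃ φ : setLanguage.BoundedFormula Empty n,
    (∀ v : Fin n → ZFSet.{u}, φ.Realize Empty.elim v ↔ P univ v) ∧
    ∀ M : Set ZFSet.{u}, IsTransitiveClass M →
      ∀ v : Fin n → M, φ.Realize Empty.elim v ↔ P M (fun i => v i)

/-! ### Properties expressible by one formula in `V` and in all transitive classes. -/

namespace IsExpressible

open FirstOrder.Language

variable {n : ℕ} {P Q : Set ZFSet.{u} → (Fin n → ZFSet.{u}) → Prop}

theorem congr (h : IsExpressible P) (e : ∀ C v, P C v ↔ Q C v) : IsExpressible Q := by
  obtain rfl : P = Q := by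
    funext C v
    exact propext (e C v)
  exact h

theorem mem (i j : Fin n) : IsExpressible fun (_ : Set ZFSet.{u}) v => v i ∈ v j :=
  ⟨(show setLanguage.Relations 2 from SetTheoryRel.mem).boundedFormula₂ (&i) (&j),
    fun v => by
      rw [BoundedFormula.realize_rel₂]
      exact Iff.rfl,
    fun M _ v => by
      rw [BoundedFormula.realize_rel₂]
      exact Iff.rfl⟩

theorem eq (i j : Fin n) : IsExpressible fun (_ : Set ZFSet.{u}) v => v i = v j :=
  ⟨(&i) =' (&j), fun v => by simp, fun M _ v => by simp [Subtype.ext_iff]⟩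

theorem not (h : IsExpressible P) : IsExpressible fun C v => ¬ P C v := by
  obtain ⟨φ, h₁, h₂⟩ := h
  exact ⟨∼φ, fun v => by simp [h₁], fun M hM v => by simp [h₂ M hM]⟩

theorem imp (h : IsExpressible P) (h' : IsExpressible Q) :
    IsExpressible fun C v => P C v → Q C v := by
  obtain ⟨φ, h₁, h₂⟩ := h
  obtain ⟨ψ, h₃, h₄⟩ := h'
  exact ⟨φ.imp ψ, fun v => by simp [h₁, h₃], fun M hM v => by simp [h₂ M hM, h₄ M hM]⟩

theorem and (h : IsExpressible P) (h' : IsExpressible Q) :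
    IsExpressible fun C v => P C v ∧ Q C v :=
  (h.imp h'.not).not.congr fun _ _ => by tauto

theorem or (h : IsExpressible P) (h' : IsExpressible Q) :
    IsExpressible fun C v => P C v ∨ Q C v :=
  (h.not.imp h').congr fun _ _ => by tauto

theorem iff (h : IsExpressible P) (h' : IsExpressible Q) :
    IsExpressible fun C v => P C v ↔ Q C v :=
  ((h.imp h').and (h'.imp h)).congr fun _ _ => by tauto

theorem all {R : Set ZFSet.{u} → (Fin n → ZFSet.{u}) → ZFSet.{u} → Prop}
    (h : IsExpressible fun C (w : Fin (n + 1) → ZFSet.{u}) => R C (Fin.init w) (w (Fin.last n))) :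
    IsExpressible fun C v => ∀ x ∈ C, R C v x := by
  obtain ⟨φ, h₁, h₂⟩ := h
  refine ⟨φ.all, fun v => by simp [h₁], fun M hM v => ?_⟩
  simp only [BoundedFormula.realize_all, h₂ M hM, Fin.snoc_last, Subtype.forall]
  refine forall₂_congr fun x hx => ?_
  have : Fin.init (fun i => ((Fin.snoc v ⟨x, hx⟩ : Fin (n + 1) → M) i : ZFSet.{u})) =
      fun i => (v i : ZFSet.{u}) := by
    funext i
    simp [Fin.init]
  rw [this]

theorem ex {R : Set ZFSet.{u} → (Fin n → ZFSet.{u}) → ZFSet.{u} → Prop}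
    (h : IsExpressible fun C (w : Fin (n + 1) → ZFSet.{u}) => R C (Fin.init w) (w (Fin.last n))) :
    IsExpressible fun C v => ∃ x ∈ C, R C v x :=
  (IsExpressible.all (R := fun C v x => ¬ R C v x) h.not).not.congr fun _ _ => by simp

/-- Transitivity of `M` enters here: elements of a member of `M` lie in `M`, so bounded quantifiers
need no relativization. -/
theorem ball (i : Fin n) {R : Set ZFSet.{u} → (Fin n → ZFSet.{u}) → ZFSet.{u} → Prop}
    (h : IsExpressible fun C (w : Fin (n + 1) → ZFSet.{u}) => R C (Fin.init w) (w (Fin.last n))) :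
    IsExpressible fun C v => ∀ x ∈ v i, R C v x := by
  obtain ⟨φ, h₁, h₂⟩ := IsExpressible.all (R := fun C v x => x ∈ v i → R C v x)
    ((IsExpressible.mem (Fin.last n) i.castSucc).imp h)
  refine ⟨φ, fun v => by simp [h₁], fun M hM v => ?_⟩
  rw [h₂ M hM]
  exact ⟨fun H x hx => H x (hM _ (v i).2 x hx) hx, fun H x _ hx => H x hx⟩

theorem bex (i : Fin n) {R : Set ZFSet.{u} → (Fin n → ZFSet.{u}) → ZFSet.{u} → Prop}
    (h : IsExpressible fun C (w : Fin (n + 1) → ZFSet.{u}) => R C (Fin.init w) (w (Fin.last n))) :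
    IsExpressible fun C v => ∃ x ∈ v i, R C v x :=
  (IsExpressible.ball i (R := fun C v x => ¬ R C v x) h.not).not.congr fun _ _ => by simp

theorem subset (i j : Fin n) : IsExpressible fun (_ : Set ZFSet.{u}) v => v i ⊆ v j :=
  IsExpressible.congr (.ball i (R := fun _ v x => x ∈ v j) (.mem _ j.castSucc)) fun _ _ => Iff.rfl

theorem eq_unorderedPair (i j k : Fin n) :
    IsExpressible fun (_ : Set ZFSet.{u}) v => v i = {v j, v k} :=
  IsExpressible.congr (.and (.mem j i) (.and (.mem k i) (.ball i
    (R := fun _ v x => x = v j ∨ x = v k) (.or (.eq _ j.castSucc) (.eq _ k.castSucc))))) fun _ v => by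
    refine ⟨fun ⟨h₁, h₂, h₃⟩ => ZFSet.ext fun z => ?_, fun h => ?_⟩
    · rw [ZFSet.mem_pair]
      exact ⟨h₃ z, by rintro (rfl | rfl) <;> assumption⟩
    · simp [h]

theorem eq_pair (i j k : Fin n) :
    IsExpressible fun (_ : Set ZFSet.{u}) v => v i = ZFSet.pair (v j) (v k) :=
  IsExpressible.congr (.and (.bex i (R := fun _ v x => x = {v j, v j})
      (eq_unorderedPair _ j.castSucc j.castSucc))
    (.and (.bex i (R := fun _ v x => x = {v j, v k}) (eq_unorderedPair _ j.castSucc k.castSucc))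
      (.ball i (R := fun _ v x => x = {v j, v j} ∨ x = {v j, v k})
        (.or (eq_unorderedPair _ j.castSucc j.castSucc)
          (eq_unorderedPair _ j.castSucc k.castSucc))))) fun _ v => by
    simp only [ZFSet.pair, ZFSet.pair_eq_singleton]
    refine ⟨fun ⟨⟨a, ha, ha'⟩, ⟨b, hb, hb'⟩, h₃⟩ => ZFSet.ext fun z => ?_, fun h => ?_⟩
    · rw [ZFSet.mem_pair]
      exact ⟨h₃ z, by rintro (rfl | rfl) <;> simp_all⟩
    · simp [h]

theorem pair_mem (i j k : Fin n) :
    IsExpressible fun (_ : Set ZFSet.{u}) v => ZFSet.pair (v i) (v j) ∈ v k :=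
  IsExpressible.congr (.bex k (R := fun _ v x => x = ZFSet.pair (v i) (v j))
    (eq_pair _ i.castSucc j.castSucc)) fun _ v => by simp

end IsExpressible

/-- `f` relates every element of `X` to some element of `Y`, and distinct elements of `X` are
never related to the same element of `Y`. -/
def ZFSet.IsInjRel (f X Y : ZFSet.{u}) : Prop :=
  (∀ x ∈ X, ∃ y ∈ Y, ZFSet.pair x y ∈ f) ∧
    ∀ x ∈ X, ∀ x' ∈ X, ∀ y ∈ Y, ZFSet.pair x y ∈ f → ZFSet.pair x' y ∈ f → x = x'

theorem IsExpressible.isInjRel {n : ℕ} (i j k : Fin n) :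
    IsExpressible fun (_ : Set ZFSet.{u}) v => (v i).IsInjRel (v j) (v k) := by
  unfold ZFSet.IsInjRel
  refine .and (.ball _ (.bex k.castSucc (.pair_mem _ _ i.castSucc.castSucc))) ?_
  refine .ball _ (.ball j.castSucc (.ball k.castSucc.castSucc (.imp ?_ (.imp ?_ ?_))))
  · exact .pair_mem (Fin.castSucc (Fin.castSucc (Fin.last _))) _ i.castSucc.castSucc.castSucc
  · exact .pair_mem (Fin.castSucc (Fin.last _)) _ i.castSucc.castSucc.castSucc
  · exact .eq (Fin.castSucc (Fin.castSucc (Fin.last _))) (Fin.castSucc (Fin.last _))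

theorem elementary_iff {M : Set ZFSet.{u}} (hM : IsTransitiveClass M)
    (j : ZFSet.{u} ↪ₑ[setLanguage] M)
    {n : ℕ} {P : Set ZFSet.{u} → (Fin n → ZFSet.{u}) → Prop} (h : IsExpressible P)
    (v : Fin n → ZFSet.{u}) : P univ v ↔ P M fun i => j (v i) := by
  obtain ⟨φ, h₁, h₂⟩ := h
  rw [← h₁, ← j.map_boundedFormula φ, ← h₂ M hM]
  rw [iff_iff_eq]
  congr 1
  exact Subsingleton.elim (α := Empty → M) _ _

/-! ### Coding of subsets and maps by sets. -/

namespace Ordinal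

/-- The canonical bijection from `o.ToType` to the von Neumann ordinal `o`. -/
noncomputable def enc (o : Ordinal.{u}) (a : o.ToType) : ZFSet.{u} :=
  (a.toOrd : Ordinal.{u}).toZFSet

theorem enc_mem_enc_iff {o : Ordinal.{u}} {a b : o.ToType} : o.enc a ∈ o.enc b ↔ a < b := by
  rw [enc, enc, Ordinal.toZFSet_mem_toZFSet_iff, Subtype.coe_lt_coe, OrderIso.lt_iff_lt]

theorem enc_injective (o : Ordinal.{u}) : Function.Injective o.enc := fun a b h => by
  simpa using Subtype.ext (Ordinal.toZFSet_injective h)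

theorem mem_toZFSet_iff_exists_enc {o : Ordinal.{u}} {x : ZFSet.{u}} :
    x ∈ o.toZFSet ↔ ∃ a, o.enc a = x := by
  rw [Ordinal.mem_toZFSet_iff]
  constructor
  · rintro ⟨a, ha, rfl⟩
    exact ⟨ToType.mk ⟨a, ha⟩, by simp [enc]⟩
  · rintro ⟨a, rfl⟩
    exact ⟨_, a.toOrd.2, rfl⟩

end Ordinal

/-- A type of cardinality `c` is in bijection with the von Neumann ordinal `c.ord`. -/
theorem exists_injective_range_eq (X : Type u) :
    ∃ e : X → ZFSet.{u}, Function.Injective e ∧ ∀ z, z ∈ (#X).ord.toZFSet ↔ ∃ x, e x = z := by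
  obtain ⟨f⟩ : Nonempty (X ≃ (#X).ord.ToType) := Cardinal.eq.1 (mk_ord_toType _).symm
  refine ⟨fun x => (#X).ord.enc (f x), (Ordinal.enc_injective _).comp f.injective, fun z => ?_⟩
  rw [Ordinal.mem_toZFSet_iff_exists_enc, f.surjective.exists]

namespace ZFSet

/-- The set of codes of the elements of `s`. -/
noncomputable def encSet {X : Type u} (e : X → ZFSet.{u}) (s : Set X) : ZFSet.{u} :=
  ZFSet.range fun a : s => e a

theorem mem_encSet {X : Type u} {e : X → ZFSet.{u}} {s : Set X} {z : ZFSet.{u}} :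
    z ∈ encSet e s ↔ ∃ a ∈ s, e a = z := by
  simp [encSet]

theorem apply_mem_encSet {X : Type u} {e : X → ZFSet.{u}} (he : Function.Injective e) {s : Set X}
    {a : X} : e a ∈ encSet e s ↔ a ∈ s := by
  simp [mem_encSet, he.eq_iff]

theorem encSet_injective {X : Type u} {e : X → ZFSet.{u}} (he : Function.Injective e) :
    Function.Injective (encSet e) := fun s t h => by
  ext a
  rw [← apply_mem_encSet he, h, apply_mem_encSet he]

theorem encSet_subset {X : Type u} {e : X → ZFSet.{u}} {k : ZFSet.{u}}
    (hk : ∀ z, z ∈ k ↔ ∃ a, e a = z) (s : Set X) : encSet e s ⊆ k := fun z hz => by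
  obtain ⟨a, -, ha⟩ := mem_encSet.1 hz
  exact (hk z).2 ⟨a, ha⟩

theorem eq_encSet {X : Type u} {e : X → ZFSet.{u}} {k y : ZFSet.{u}}
    (hk : ∀ z, z ∈ k ↔ ∃ a, e a = z) (hy : y ⊆ k) : y = encSet e {a | e a ∈ y} := by
  ext z
  rw [mem_encSet]
  constructor
  · intro hz
    obtain ⟨a, rfl⟩ := (hk z).1 (hy hz)
    exact ⟨a, hz, rfl⟩
  · rintro ⟨a, ha, rfl⟩
    exact ha

/-- The graph of a function between codes. -/
noncomputable def graph {X : Type u} (a b : X → ZFSet.{u}) : ZFSet.{u} :=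
  ZFSet.range fun x => ZFSet.pair (a x) (b x)

theorem pair_mem_graph {X : Type u} {a b : X → ZFSet.{u}} {y z : ZFSet.{u}} :
    ZFSet.pair y z ∈ graph a b ↔ ∃ x, a x = y ∧ b x = z := by
  simp [graph]

/-- Choosing one related element for each `x` gives an injection. With `exists_isInjRel` as
converse, cardinal inequalities become bounded statements about sets. -/
theorem IsInjRel.mk_le {f A B : ZFSet.{u}} (h : f.IsInjRel A B) {X Y : Type u} {a : X → ZFSet.{u}}
    {b : Y → ZFSet.{u}} (ha : Function.Injective a) (hA : ∀ x, a x ∈ A)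
    (hB : ∀ z ∈ B, ∃ y, b y = z) : #X ≤ #Y := by
  have H : ∀ x, ∃ y, b y ∈ B ∧ ZFSet.pair (a x) (b y) ∈ f := fun x => by
    obtain ⟨z, hz, hxz⟩ := h.1 _ (hA x)
    obtain ⟨y, rfl⟩ := hB z hz
    exact ⟨y, hz, hxz⟩
  choose g hg hg' using H
  exact Cardinal.mk_le_of_injective (f := g) fun x x' hx =>
    ha (h.2 _ (hA x) _ (hA x') _ (hg x) (hg' x) (hx ▸ hg' x'))

theorem isInjRel_graph {A B : ZFSet.{u}} {X : Type u} {a b : X → ZFSet.{u}}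
    (hb : Function.Injective b) (hA : ∀ z ∈ A, ∃ x, a x = z)
    (hB : ∀ x, b x ∈ B) : (graph a b).IsInjRel A B := by
  refine ⟨fun z hz => ?_, fun z _ z' _ y _ h h' => ?_⟩
  · obtain ⟨x, rfl⟩ := hA z hz
    exact ⟨_, hB x, pair_mem_graph.2 ⟨x, rfl, rfl⟩⟩
  · obtain ⟨x, rfl, rfl⟩ := pair_mem_graph.1 h
    obtain ⟨x', rfl, hx⟩ := pair_mem_graph.1 h'
    rw [hb hx]

theorem exists_isInjRel {A B : ZFSet.{u}} {X Y : Type u} {a : X → ZFSet.{u}} {b : Y → ZFSet.{u}}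
    (hb : Function.Injective b) (hA : ∀ z ∈ A, ∃ x, a x = z) (hB : ∀ y, b y ∈ B) (h : #X ≤ #Y) :
    ∃ g : X → Y, (graph a (b ∘ g)).IsInjRel A B := by
  obtain ⟨g⟩ := h
  exact ⟨g, isInjRel_graph (hb.comp g.injective) hA fun x => hB _⟩

end ZFSet

/-! ### Elementary embeddings and their critical points. -/

section Embedding

variable {M : Set ZFSet.{u}} (hM : IsTransitiveClass M) (j : ZFSet.{u} ↪ₑ[setLanguage] M)
include hM

theorem embedding_mem_iff {x y : ZFSet.{u}} : (j x : ZFSet.{u}) ∈ (j y : ZFSet.{u}) ↔ x ∈ y :=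
  (elementary_iff hM j (.mem 0 1) ![x, y]).symm

theorem embedding_subset {x y : ZFSet.{u}} (h : x ⊆ y) : (j x : ZFSet.{u}) ⊆ j y :=
  (elementary_iff hM j (.subset 0 1) ![x, y]).1 h

theorem embedding_pair (x y : ZFSet.{u}) :
    (j (ZFSet.pair x y) : ZFSet.{u}) = ZFSet.pair (j x) (j y) :=
  (elementary_iff hM j (.eq_pair 0 1 2) ![ZFSet.pair x y, x, y]).1 rfl

theorem embedding_empty : (j ∅ : ZFSet.{u}) = ∅ := by
  have h : IsExpressible fun (_ : Set ZFSet.{u}) (v : Fin 1 → ZFSet.{u}) => ∀ x ∈ v 0, x ≠ x :=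
    .ball _ (.not (.eq _ _))
  have := (elementary_iff hM j h ![∅]).1 (by simp)
  exact (ZFSet.eq_empty _).2 fun y hy => this y hy rfl

theorem isOrdinal_embedding {x : ZFSet.{u}} (hx : x.IsOrdinal) : (j x : ZFSet.{u}).IsOrdinal := by
  have h : IsExpressible fun (_ : Set ZFSet.{u}) (v : Fin 1 → ZFSet.{u}) =>
      (∀ y ∈ v 0, y ⊆ v 0) ∧ ∀ y ∈ v 0, ∀ z ∈ y, z ⊆ y :=
    .and (.ball _ (.subset _ _)) (.ball _ (.ball (Fin.last _) (.subset _ (Fin.castSucc (Fin.last _)))))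
  exact ZFSet.isOrdinal_iff_forall_mem_isTransitive.2
    ((elementary_iff hM j h ![x]).1 (ZFSet.isOrdinal_iff_forall_mem_isTransitive.1 hx))

theorem embedding_insert_self (x : ZFSet.{u}) :
    (j (insert x x) : ZFSet.{u}) = insert (j x : ZFSet.{u}) (j x : ZFSet.{u}) := by
  have h : IsExpressible fun (_ : Set ZFSet.{u}) (v : Fin 2 → ZFSet.{u}) =>
      v 1 ∈ v 0 ∧ (∀ z ∈ v 1, z ∈ v 0) ∧ ∀ z ∈ v 0, z = v 1 ∨ z ∈ v 1 :=
    .and (.mem _ _) (.and (.ball _ (.mem _ _)) (.ball _ (.or (.eq _ _) (.mem _ _))))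
  obtain ⟨h₁, h₂, h₃⟩ := (elementary_iff hM j h ![insert x x, x]).1
    ⟨by simp, fun z hz => by simpa using .inr hz, fun z hz => by simpa using hz⟩
  ext z
  rw [ZFSet.mem_insert_iff]
  exact ⟨h₃ z, by rintro (rfl | hz); exacts [h₁, h₂ z hz]⟩

theorem embedding_pair_mem {x y f : ZFSet.{u}} (h : ZFSet.pair x y ∈ f) :
    ZFSet.pair (j x : ZFSet.{u}) (j y) ∈ (j f : ZFSet.{u}) := by
  rw [← embedding_pair hM]
  exact (embedding_mem_iff hM j).2 h

include j in
theorem pair_mem_class {x y : ZFSet.{u}} (hx : x ∈ M) (hy : y ∈ M) : ZFSet.pair x y ∈ M := by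
  have h : IsExpressible fun (C : Set ZFSet.{u}) (_ : Fin 0 → ZFSet.{u}) =>
      ∀ x ∈ C, ∀ y ∈ C, ∃ p ∈ C, p = ZFSet.pair x y :=
    .all (.all (.ex (.eq_pair _ (Fin.castSucc (Fin.castSucc (Fin.last _))) (Fin.castSucc (Fin.last _)))))
  obtain ⟨p, hp, rfl⟩ := (elementary_iff hM j h ![]).1 (by simp) x hx y hy
  exact hp

include j in
/-- A class closed under `lam`-sequences contains its subsets of size at most `lam`. -/
theorem range_mem_class {lam : Cardinal.{u}} (hcl : ClosedUnderSequences M lam) {X : Type u}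
    (g : X → ZFSet.{u}) (hg : ∀ x, g x ∈ M) (hX : #X ≤ lam) : ZFSet.range g ∈ M := by
  rcases isEmpty_or_nonempty X with hX' | hX'
  · have : ZFSet.range g = ∅ := by
      ext
      simp
    rw [this, ← embedding_empty hM j]
    exact (j ∅).2
  obtain ⟨e, he⟩ : ∃ e : lam.ord.ToType → X, Function.Surjective e := by
    obtain ⟨e⟩ : Nonempty (X ↪ lam.ord.ToType) := by
      rwa [← Cardinal.le_def, mk_ord_toType]
    exact ⟨_, Function.invFun_surjective e.injective⟩
  have hf : ZFSet.graph lam.ord.enc (g ∘ e) ∈ M := by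
    refine hcl (ZFSet.range g) _ (by simpa using hg) ⟨fun p hp => ?_, fun z hz => ?_⟩
    · obtain ⟨x, rfl⟩ := ZFSet.mem_range.1 hp
      exact ZFSet.pair_mem_prod.2 ⟨Ordinal.mem_toZFSet_iff_exists_enc.2 ⟨x, rfl⟩, by simp⟩
    · obtain ⟨x, rfl⟩ := Ordinal.mem_toZFSet_iff_exists_enc.1 hz
      refine ⟨g (e x), ZFSet.pair_mem_graph.2 ⟨x, rfl, rfl⟩, fun y hy => ?_⟩
      obtain ⟨x', hx', rfl⟩ := ZFSet.pair_mem_graph.1 hy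
      rw [Ordinal.enc_injective _ hx']
      rfl
  -- Closure only puts the sequence into `M`; its range follows by elementarity, since every set of
  -- pairs in `V` has a range. The variable `t ∈ p` makes the coordinates of `p` reachable by
  -- bounded quantifiers.
  have h : IsExpressible fun (C : Set ZFSet.{u}) (_ : Fin 0 → ZFSet.{u}) =>
      ∀ f ∈ C, ∃ r ∈ C, (∀ p ∈ f, ∀ t ∈ p, ∀ x ∈ t, ∀ y ∈ t, p = ZFSet.pair x y → y ∈ r) ∧
        ∀ y ∈ r, ∃ p ∈ f, ∃ t ∈ p, ∃ x ∈ t, p = ZFSet.pair x y := by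
    repeat' first
      | apply IsExpressible.all | apply IsExpressible.ex | apply IsExpressible.and
      | apply IsExpressible.ball | apply IsExpressible.bex | apply IsExpressible.imp
      | apply IsExpressible.eq_pair | apply IsExpressible.mem
  have mem_right : ∀ x y : ZFSet.{u}, ({x, y} : ZFSet.{u}) ∈ ZFSet.pair x y := by simp [ZFSet.pair]
  obtain ⟨r, hr, hr₁, hr₂⟩ := (elementary_iff hM j h ![]).1 (fun f _ => by
    refine ⟨(ZFSet.sUnion (ZFSet.sUnion f)).sep fun y => ∃ x, ZFSet.pair x y ∈ f, mem_univ _,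
      fun p hp t ht x _ y hy hxy => ?_, fun y hy => ?_⟩
    · subst hxy
      exact ZFSet.mem_sep.2 ⟨ZFSet.mem_sUnion.2 ⟨t, ZFSet.mem_sUnion.2 ⟨_, hp, ht⟩, hy⟩, x, hp⟩
    · obtain ⟨x, hx⟩ := (ZFSet.mem_sep.1 hy).2
      exact ⟨_, hx, {x, y}, mem_right x y, x, by simp, rfl⟩) _ hf
  suffices ZFSet.range g = r by rwa [this]
  ext z
  rw [ZFSet.mem_range]
  constructor
  · rintro ⟨x, rfl⟩
    obtain ⟨i, rfl⟩ := he x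
    exact hr₁ _ (ZFSet.pair_mem_graph.2 ⟨i, rfl, rfl⟩) _ (mem_right _ _) _ (by simp) _ (by simp) rfl
  · intro hz
    obtain ⟨p, hp, t, -, x, -, rfl⟩ := hr₂ z hz
    obtain ⟨i, -, rfl⟩ := ZFSet.pair_mem_graph.1 hp
    exact ⟨_, rfl⟩

variable {κ : Cardinal.{u}} (hκ : IsCriticalPoint j κ.ord)
include hκ

omit hM in
theorem embedding_ord_of_lt {β : Ordinal.{u}} (hβ : β < κ.ord) :
    (j β.toZFSet : ZFSet.{u}) = β.toZFSet := by
  by_contra h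
  exact (hκ.2 h).not_gt hβ

omit hM in
theorem embedding_enc (a : κ.ord.ToType) : (j (κ.ord.enc a) : ZFSet.{u}) = κ.ord.enc a :=
  embedding_ord_of_lt j hκ a.toOrd.2

theorem ord_subset_embedding : κ.ord.toZFSet ⊆ (j κ.ord.toZFSet : ZFSet.{u}) := fun z hz => by
  obtain ⟨a, rfl⟩ := Ordinal.mem_toZFSet_iff_exists_enc.1 hz
  rw [← embedding_enc j hκ]
  exact (embedding_mem_iff hM j).2 hz

/-- The ordinal `j κ` includes `κ` and differs from it by criticality. -/
theorem ord_mem_embedding : κ.ord.toZFSet ∈ (j κ.ord.toZFSet : ZFSet.{u}) := by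
  have h := ord_subset_embedding hM j hκ
  rw [ZFSet.IsOrdinal.subset_iff_eq_or_mem (ZFSet.isOrdinal_toZFSet _)
    (isOrdinal_embedding hM j (ZFSet.isOrdinal_toZFSet _))] at h
  exact h.resolve_left (Ne.symm hκ.1)

omit hM in
theorem enc_mem_class (a : κ.ord.ToType) : κ.ord.enc a ∈ M := by
  rw [← embedding_enc j hκ]
  exact (j _).2

/-- The embedding fixes the subsets of the ordinals below the critical point. -/
theorem embedding_eq_of_subset {β : Ordinal.{u}} (hβ : β < κ.ord) {x : ZFSet.{u}}
    (hx : x ⊆ β.toZFSet) : (j x : ZFSet.{u}) = x := by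
  have hfix : ∀ z ∈ β.toZFSet, (j z : ZFSet.{u}) = z := fun z hz => by
    obtain ⟨γ, hγ, rfl⟩ := Ordinal.mem_toZFSet_iff.1 hz
    exact embedding_ord_of_lt j hκ (hγ.trans hβ)
  ext z
  constructor
  · intro hz
    have hzβ := embedding_subset hM j hx hz
    rw [embedding_ord_of_lt j hκ hβ] at hzβ
    rwa [← embedding_mem_iff hM j, hfix z hzβ]
  · intro hz
    rw [← hfix z (hx hz)]
    exact (embedding_mem_iff hM j).2 hz

theorem aleph0_lt_of_isCriticalPoint : ℵ₀ < κ := by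
  have hsucc : ∀ o : Ordinal.{u}, κ.ord ≠ Order.succ o := fun o ho => by
    apply hκ.1
    rw [ho, Order.succ_eq_add_one, Ordinal.toZFSet_add_one, embedding_insert_self hM,
      embedding_ord_of_lt j hκ (ho ▸ Order.lt_succ o)]
  have hle : ℵ₀ ≤ κ := by
    by_contra! h
    obtain ⟨n, rfl⟩ := Cardinal.lt_aleph0.1 h
    cases n with
    | zero => exact hκ.1 (by simp [embedding_empty hM])
    | succ n => exact hsucc n (by rw [Cardinal.ord_natCast, Nat.cast_succ, Order.succ_eq_add_one])
  refine hle.lt_of_ne ?_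
  rintro rfl
  -- Every element of `ω` is empty or has a largest element; `ω` itself, an element of `j ω` in this
  -- case, is neither.
  have h : IsExpressible fun (_ : Set ZFSet.{u}) (v : Fin 1 → ZFSet.{u}) =>
      ∀ x ∈ v 0, (∀ y ∈ x, y ≠ y) ∨ ∃ y ∈ x, ∀ z ∈ x, z = y ∨ z ∈ y := by
    repeat' first
      | apply IsExpressible.or | apply IsExpressible.not
      | apply IsExpressible.ball | apply IsExpressible.bex
      | apply IsExpressible.eq | apply IsExpressible.mem
  have := (elementary_iff hM j h ![(ℵ₀ : Cardinal.{u}).ord.toZFSet]).1 (fun x hx => ?_) _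
    (ord_mem_embedding hM j hκ)
  · obtain h | ⟨y, hy, h⟩ := this
    · exact h (Ordinal.toZFSet 0) (by rw [Ordinal.toZFSet_mem_toZFSet_iff]; simp) rfl
    · obtain ⟨β, hβ, rfl⟩ := Ordinal.mem_toZFSet_iff.1 hy
      have hβ' : Order.succ β < (ℵ₀ : Cardinal.{u}).ord :=
        (isSuccLimit_ord le_rfl).succ_lt hβ
      rcases h _ (Ordinal.toZFSet_mem_toZFSet_iff.2 hβ') with h | h
      · exact (Order.lt_succ β).ne' (Ordinal.toZFSet_injective h)
      · exact (Ordinal.toZFSet_mem_toZFSet_iff.1 h).not_gt (Order.lt_succ β)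
  · obtain ⟨β, hβ, rfl⟩ := Ordinal.mem_toZFSet_iff.1 hx
    obtain ⟨n, rfl⟩ := Ordinal.lt_omega0.1 (by simpa using hβ)
    cases n with
    | zero => simp
    | succ n =>
      refine .inr ⟨(n : Ordinal.{u}).toZFSet, ?_, fun z hz => ?_⟩
      · simp
      · simpa using hz

end Embedding

/-! ### Inaccessibility and ultrafilters from a critical point. -/

section Embedding

variable {M : Set ZFSet.{u}} (hM : IsTransitiveClass M) (j : ZFSet.{u} ↪ₑ[setLanguage] M)
  {κ : Cardinal.{u}} (hκ : IsCriticalPoint j κ.ord)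
include hM hκ

/-- A function from a critical point `κ` to the power set of a smaller cardinal is constant on an
unbounded set. -/
theorem exists_unbounded_fiber {x : Cardinal.{u}} (hx : x < κ) {X : Type u} (hX : #X ≤ 2 ^ x)
    (g : κ.ord.ToType → X) : ∃ q, ∀ a, ∃ b, a < b ∧ g b = q := by
  have hx' : x.ord < κ.ord := Cardinal.ord_lt_ord.2 hx
  obtain ⟨e⟩ : Nonempty (X ↪ Set x.ord.ToType) := by
    rwa [← Cardinal.le_def, Cardinal.mk_set, mk_ord_toType]
  set y : X → ZFSet.{u} := fun q => ZFSet.encSet x.ord.enc (e q) with hy_def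
  have hy : Function.Injective y :=
    (ZFSet.encSet_injective (Ordinal.enc_injective _)).comp e.injective
  have hyx : ∀ q, y q ⊆ x.ord.toZFSet := fun q =>
    ZFSet.encSet_subset (fun _ => Ordinal.mem_toZFSet_iff_exists_enc) _
  set f := ZFSet.graph κ.ord.enc (y ∘ g) with hf
  have h₁ : IsExpressible fun (_ : Set ZFSet.{u}) (v : Fin 3 → ZFSet.{u}) =>
      ∀ i ∈ v 0, ∃ p ∈ v 1, ZFSet.pair i p ∈ v 2 :=
    .ball _ (.bex _ (.pair_mem (Fin.castSucc (Fin.last _)) _ _))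
  -- The constant value is the value `p` of `j f` at `κ`: it is a subset of `x`, hence fixed by `j`,
  -- hence a value of `f`.
  obtain ⟨p, hp, hpf⟩ := (elementary_iff hM j h₁ ![κ.ord.toZFSet, ZFSet.range y, f]).1
    (fun i hi => by
      obtain ⟨a, rfl⟩ := Ordinal.mem_toZFSet_iff_exists_enc.1 hi
      exact ⟨y (g a), by simp, ZFSet.pair_mem_graph.2 ⟨a, rfl, rfl⟩⟩) _ (ord_mem_embedding hM j hκ)
  have h₂ : IsExpressible fun (_ : Set ZFSet.{u}) (v : Fin 2 → ZFSet.{u}) =>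
      ∀ p ∈ v 0, p ⊆ v 1 := .ball _ (.subset _ _)
  have hpx : p ⊆ x.ord.toZFSet := by
    rw [← embedding_ord_of_lt j hκ hx']
    exact (elementary_iff hM j h₂ ![ZFSet.range y, x.ord.toZFSet]).1 (fun p hp => by
      obtain ⟨q, rfl⟩ := ZFSet.mem_range.1 hp
      exact hyx q) p hp
  have hjp := embedding_eq_of_subset hM j hκ hx' hpx
  obtain ⟨q, rfl⟩ : ∃ q, y q = p := by
    rw [← ZFSet.mem_range, ← embedding_mem_iff hM j, hjp]
    exact hp
  refine ⟨q, fun a => ?_⟩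
  have h₃ : IsExpressible fun (_ : Set ZFSet.{u}) (v : Fin 4 → ZFSet.{u}) =>
      ∃ i ∈ v 0, v 1 ∈ i ∧ ZFSet.pair i (v 2) ∈ v 3 :=
    .bex _ (.and (.mem (Fin.castSucc _) _) (.pair_mem _ (Fin.castSucc _) _))
  -- In `M`, the index `κ` lies above `a` and `j f` takes the value `p` there; this reflects to some
  -- index below `κ`.
  obtain ⟨i, hi, hai, hif⟩ := (elementary_iff hM j h₃ ![κ.ord.toZFSet, κ.ord.enc a, y q, f]).2
    ⟨κ.ord.toZFSet, ord_mem_embedding hM j hκ, by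
      change (j (κ.ord.enc a) : ZFSet.{u}) ∈ _
      rw [embedding_enc j hκ]
      exact Ordinal.mem_toZFSet_iff_exists_enc.2 ⟨a, rfl⟩, by
      change ZFSet.pair _ (j (y q) : ZFSet.{u}) ∈ (j f : ZFSet.{u})
      rwa [hjp]⟩
  obtain ⟨b, rfl, hb⟩ := ZFSet.pair_mem_graph.1 hif
  exact ⟨b, Ordinal.enc_mem_enc_iff.1 hai, hy hb⟩

/-- A choice of bounds in a short cofinal set, or an injection of `κ` into the power set of a
smaller cardinal, would be constant on an unbounded set. -/
theorem isInaccessible_of_isCriticalPoint : κ.IsInaccessible := by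
  have h0 := aleph0_lt_of_isCriticalPoint hM j hκ
  have hne : Nonempty κ.ord.ToType := by
    rw [Ordinal.nonempty_toType_iff]
    simpa using (aleph0_pos.trans h0).ne'
  refine ⟨h0, ?_, fun x hx => ?_⟩
  · rw [← Ordinal.cof_toType, Order.le_cof_iff]
    intro s hs
    by_contra! hlt
    choose g hg hg' using hs
    obtain ⟨q, hq⟩ := exists_unbounded_fiber hM j hκ hlt (cantor _).le
      fun a => (⟨g a, hg a⟩ : s)
    obtain ⟨b, hb, rfl⟩ := hq q
    exact (hg' b).not_gt hb
  · by_contra! hle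
    obtain ⟨g⟩ : Nonempty (κ.ord.ToType ↪ Set x.ord.ToType) := by
      rwa [← Cardinal.le_def, Cardinal.mk_set, mk_ord_toType, mk_ord_toType]
    obtain ⟨q, hq⟩ := exists_unbounded_fiber hM j hκ hx
      (by rw [Cardinal.mk_set, mk_ord_toType]) g
    obtain ⟨b, -, hb⟩ := hq hne.some
    obtain ⟨c, hbc, hc⟩ := hq b
    exact hbc.ne (g.injective (hb.trans hc.symm))

/-- An element of `j κ` generates a `κ`-complete ultrafilter over `κ`. -/
theorem exists_ultrafilter_of_mem_embedding {z : ZFSet.{u}}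
    (hz : z ∈ (j κ.ord.toZFSet : ZFSet.{u})) :
    ∃ U : Ultrafilter κ.ord.ToType, CardinalInterFilter (U : Filter κ.ord.ToType) κ ∧
      ∀ s, s ∈ U ↔ z ∈ (j (ZFSet.encSet κ.ord.enc s) : ZFSet.{u}) := by
  have hk : ∀ z, z ∈ κ.ord.toZFSet ↔ ∃ a, κ.ord.enc a = z := fun _ =>
    Ordinal.mem_toZFSet_iff_exists_enc
  set E := ZFSet.encSet κ.ord.enc
  have hE : ∀ {a s}, κ.ord.enc a ∈ E s ↔ a ∈ s := ZFSet.apply_mem_encSet (Ordinal.enc_injective _)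
  have hmono : ∀ s t, s ⊆ t → z ∈ (j (E s) : ZFSet.{u}) → z ∈ (j (E t) : ZFSet.{u}) :=
    fun s t hst h => embedding_subset hM j (fun y hy => by
      obtain ⟨a, ha, rfl⟩ := ZFSet.mem_encSet.1 hy
      exact hE.2 (hst ha)) h
  have hcompl : ∀ s, z ∈ (j (E sᶜ) : ZFSet.{u}) ↔ z ∉ (j (E s) : ZFSet.{u}) := fun s => by
    have h : IsExpressible fun (_ : Set ZFSet.{u}) (v : Fin 3 → ZFSet.{u}) =>
        ∀ t ∈ v 0, (t ∈ v 1 ↔ ¬ t ∈ v 2) := .ball _ (.iff (.mem _ _) (.not (.mem _ _)))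
    exact (elementary_iff hM j h ![κ.ord.toZFSet, E sᶜ, E s]).1 (fun t ht => by
      obtain ⟨a, rfl⟩ := (hk t).1 ht
      change _ ∈ E _ ↔ ¬ _ ∈ E _
      rw [hE, hE]
      rfl) z hz
  have hinter : ∀ S : Set (Set κ.ord.ToType), #S < κ →
      (∀ s ∈ S, z ∈ (j (E s) : ZFSet.{u})) → z ∈ (j (E (⋂₀ S)) : ZFSet.{u}) := fun S hS h => by
    obtain ⟨e, hinj, he⟩ := exists_injective_range_eq S
    -- The family is indexed by an ordinal below `κ`; `j` fixes that ordinal and all indices, so it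
    -- adds no new members to the family.
    have hφ : IsExpressible fun (_ : Set ZFSet.{u}) (v : Fin 5 → ZFSet.{u}) =>
        ∀ t ∈ v 0, (∀ i ∈ v 1, ∃ y ∈ v 2, ZFSet.pair i y ∈ v 3 ∧ t ∈ y) → t ∈ v 4 :=
      .ball _ (.imp (.ball _ (.bex _ (.and (.pair_mem (Fin.castSucc (Fin.last _)) _ _)
        (.mem (Fin.castSucc (Fin.castSucc (Fin.last _))) _)))) (.mem _ _))
    refine (elementary_iff hM j hφ ![κ.ord.toZFSet, (#S).ord.toZFSet,
      ZFSet.range fun s : S => E s, ZFSet.graph e fun s : S => E s, E (⋂₀ S)]).1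
      (fun t ht hi => ?_) z hz fun i hi => ?_
    · obtain ⟨a, rfl⟩ := (hk t).1 ht
      refine hE.2 (mem_sInter.2 fun s hs => ?_)
      obtain ⟨y, -, hy, hay⟩ := hi _ ((he _).2 ⟨⟨s, hs⟩, rfl⟩)
      obtain ⟨s', hs', rfl⟩ := ZFSet.pair_mem_graph.1 hy
      rw [hinj hs'] at hay
      exact hE.1 hay
    · change i ∈ (j (#S).ord.toZFSet : ZFSet.{u}) at hi
      rw [embedding_ord_of_lt j hκ (Cardinal.ord_lt_ord.2 hS)] at hi
      obtain ⟨s, rfl⟩ := (he i).1 hi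
      refine ⟨j (E s), (embedding_mem_iff hM j).2 (by simp), ?_, h s s.2⟩
      have := embedding_pair_mem hM j (ZFSet.pair_mem_graph.2 ⟨s, rfl, rfl⟩ :
        ZFSet.pair (e s) (E s) ∈ ZFSet.graph e fun s : S => E s)
      rwa [embedding_eq_of_subset hM j hκ (Cardinal.ord_lt_ord.2 hS)
        ((ZFSet.isOrdinal_toZFSet _).subset_of_mem hi)] at this
  let F : Filter κ.ord.ToType :=
    { sets := {s | z ∈ (j (E s) : ZFSet.{u})}
      univ_sets := by
        have h0 : E ∅ = ∅ := (ZFSet.eq_empty _).2 fun y hy => by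
          simpa using ZFSet.mem_encSet.1 hy
        rw [Set.mem_ofPred_eq, ← compl_empty, hcompl, h0, embedding_empty hM]
        exact ZFSet.notMem_empty _
      sets_of_superset := fun h hst => hmono _ _ hst h
      inter_sets := fun {s t} hs ht => by
        rw [Set.mem_ofPred_eq, ← sInter_pair]
        refine hinter _ (lt_trans ?_ (aleph0_lt_of_isCriticalPoint hM j hκ)) ?_
        · exact Cardinal.lt_aleph0_of_finite _
        · rintro r (rfl | rfl) <;> assumption }
  refine ⟨Ultrafilter.ofComplNotMemIff F fun s => ?_, ⟨hinter⟩, fun s => Iff.rfl⟩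
  exact (not_congr (hcompl s)).trans not_not

/-- If `κ` is the critical point of an embedding into a class closed under `2 ^ κ`-sequences, then
every family of subsets of `κ` whose small subfamilies have nonempty intersections extends to a
`κ`-complete ultrafilter. -/
theorem exists_ultrafilter_superset {lam : Cardinal.{u}} (hcl : ClosedUnderSequences M lam)
    (hlam : 2 ^ κ ≤ lam) (B : Set (Set κ.ord.ToType))
    (hB : ∀ S ⊆ B, #S < κ → (⋂₀ S).Nonempty) :
    ∃ U : Ultrafilter κ.ord.ToType, CardinalInterFilter (U : Filter κ.ord.ToType) κ ∧
      ∀ s ∈ B, s ∈ U := by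
  have hk : ∀ z, z ∈ κ.ord.toZFSet ↔ ∃ a, κ.ord.enc a = z := fun _ =>
    Ordinal.mem_toZFSet_iff_exists_enc
  set E := ZFSet.encSet κ.ord.enc with hE_def
  have hE : ∀ {a s}, κ.ord.enc a ∈ E s ↔ a ∈ s := ZFSet.apply_mem_encSet (Ordinal.enc_injective _)
  have hEinj : Function.Injective E := ZFSet.encSet_injective (Ordinal.enc_injective _)
  have hEk : ∀ s, E s ⊆ κ.ord.toZFSet := ZFSet.encSet_subset hk
  have hjinj : Function.Injective fun x => (j x : ZFSet.{u}) :=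
    Subtype.val_injective.comp j.injective
  have hBlam : #B ≤ lam := (mk_set_le B).trans (by rwa [mk_set, mk_ord_toType])
  have hEM : ∀ s, E s ∈ M := fun s =>
    range_mem_class hM j hcl _ (fun a => enc_mem_class j hκ _)
      (((mk_set_le s).trans_eq (mk_ord_toType _)).trans ((cantor κ).le.trans hlam))
  have hS : (ZFSet.range fun s : B => (j (E s) : ZFSet.{u})) ∈ M :=
    range_mem_class hM j hcl _ (fun s => (j _).2) hBlam
  have hP : (ZFSet.range fun s : B => E s) ∈ M := range_mem_class hM j hcl _ (fun s => hEM _) hBlam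
  have hg : ZFSet.graph (fun s : B => (j (E s) : ZFSet.{u})) (fun s : B => E s) ∈ M :=
    range_mem_class hM j hcl _ (fun s => pair_mem_class hM j (j _).2 (hEM _)) hBlam
  -- In `V`, a subfamily of `B` that injects into the power set of some `α < κ` is small, as `κ` is
  -- a strong limit. In `M`, take `α = κ` and `S = j '' B`, injected by `j s ↦ s`.
  have hφ : IsExpressible fun (C : Set ZFSet.{u}) (v : Fin 2 → ZFSet.{u}) =>
      ∀ S ∈ C, ∀ P ∈ C, ∀ g ∈ C, ∀ α ∈ v 0, (∀ y ∈ S, y ∈ v 1) → (∀ y ∈ P, y ⊆ α) →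
        g.IsInjRel S P → ∃ z ∈ v 0, ∀ y ∈ S, z ∈ y := by
    repeat' first
      | apply IsExpressible.all | apply IsExpressible.isInjRel
      | apply IsExpressible.ball | apply IsExpressible.bex | apply IsExpressible.imp
      | apply IsExpressible.subset | apply IsExpressible.mem
  obtain ⟨z, hz, hzS⟩ := (elementary_iff hM j hφ ![κ.ord.toZFSet, ZFSet.range fun s : B => E s]).1
    (fun S _ P _ g _ α hα hSB hPα hg => by
      obtain ⟨β, hβ, rfl⟩ := Ordinal.mem_toZFSet_iff.1 hα
      have hlt : #(Set β.ToType) < κ := by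
        rw [mk_set, mk_toType]
        exact (isInaccessible_of_isCriticalPoint hM j hκ).isStrongLimit.isStrongPrelimit
          (Cardinal.lt_ord.1 hβ)
      obtain ⟨a, ha⟩ := hB {s | s ∈ B ∧ E s ∈ S} (fun s hs => hs.1) (lt_of_le_of_lt
        (hg.mk_le (Y := Set β.ToType) (a := fun s => E s.1) (b := ZFSet.encSet β.enc)
          (hEinj.comp Subtype.val_injective) (fun s => s.2.2)
          fun y hy => ⟨_, (ZFSet.eq_encSet (fun _ => Ordinal.mem_toZFSet_iff_exists_enc)
            (hPα y hy)).symm⟩) hlt)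
      refine ⟨κ.ord.enc a, (hk _).2 ⟨a, rfl⟩, fun y hy => ?_⟩
      obtain ⟨⟨s, hs⟩, rfl⟩ := ZFSet.mem_range.1 (hSB y hy)
      exact hE.2 (ha s ⟨hs, hy⟩)) _ hS _ hP _ hg _ (ord_mem_embedding hM j hκ)
    (fun y hy => by
      obtain ⟨s, rfl⟩ := ZFSet.mem_range.1 hy
      exact (embedding_mem_iff hM j).2 (by simp))
    (fun y hy => by
      obtain ⟨s, rfl⟩ := ZFSet.mem_range.1 hy
      exact hEk s)
    (ZFSet.isInjRel_graph (hEinj.comp Subtype.val_injective)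
      (fun z hz => ZFSet.mem_range.1 hz) fun s => by simp)
  obtain ⟨U, hU, hUz⟩ := exists_ultrafilter_of_mem_embedding hM j hκ hz
  exact ⟨U, hU, fun s hs => (hUz s).2 (hzS _ (by simpa using ⟨s, hs, rfl⟩))⟩

end Embedding

/-! ### Independent families and the non-Galvin ultrafilter. -/

/-- Hausdorff's theorem: on an inaccessible `κ` there is a `κ`-independent family of subsets of `κ`
indexed by the subsets of `κ`. -/
theorem exists_independent_family {κ : Cardinal.{u}} (hκ : κ.IsInaccessible) :
    ∃ A : Set κ.ord.ToType → Set κ.ord.ToType, ∀ s t : Set (Set κ.ord.ToType), #s < κ → #t < κ →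
      Disjoint s t → ∃ p, (∀ y ∈ s, p ∈ A y) ∧ ∀ y ∈ t, p ∉ A y := by
  let P := Σ a : κ.ord.ToType, Set (Set (Iio a))
  have hP : #P ≤ #κ.ord.ToType := by
    rw [mk_sigma]
    refine (sum_le_sum _ (fun _ => κ) fun a => ?_).trans ?_
    · rw [mk_set, mk_set]
      have ha : #(Iio a) < κ := by simpa using mk_Iio_lt a (by simp)
      exact (hκ.isStrongLimit.isStrongPrelimit (hκ.isStrongLimit.isStrongPrelimit ha)).le
    · rw [sum_const', mk_ord_toType, mul_eq_self hκ.aleph0_lt.le]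
  obtain ⟨e⟩ := hP
  -- Points code pairs `(a, F)` with `F` a family of subsets of `Iio a`; such a point belongs to the
  -- set of `Y` when the trace of `Y` below `a` is in `F`.
  refine ⟨fun Y => e '' {p | {b : Iio p.1 | (b : κ.ord.ToType) ∈ Y} ∈ p.2}, fun s t hs ht hst => ?_⟩
  have hne : ∀ q : s × t, ∃ d, ¬ (d ∈ q.1.1 ↔ d ∈ q.2.1) := fun q => by
    by_contra! h
    exact disjoint_left.1 hst q.1.2 (Set.ext h ▸ q.2.2)
  choose d hd using hne
  -- By regularity, one `a` bounds points separating each member of `s` from each member of `t`; `F`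
  -- is then the set of traces of `s`.
  obtain ⟨a, ha⟩ : ∃ a, ∀ q, d q < a := by
    by_contra! h
    have hcof : IsCofinal (range d) := fun a => by
      obtain ⟨q, hq⟩ := h a
      exact ⟨_, mem_range_self q, hq⟩
    have := (Order.le_cof_iff.1 le_rfl _ hcof).trans mk_range_le
    rw [Ordinal.cof_toType] at this
    refine (hκ.le_cof_ord.trans this).not_gt ?_
    rw [mk_prod, lift_id, lift_id]
    exact mul_lt_of_lt hκ.aleph0_lt.le hs ht
  refine ⟨e ⟨a, (fun Y => {b : Iio a | (b : κ.ord.ToType) ∈ Y}) '' s⟩, fun y hy => ?_,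
    fun y hy => ?_⟩
  · exact mem_image_of_mem e (mem_image_of_mem _ hy)
  · rw [e.injective.mem_set_image]
    rintro ⟨x, hx, hxy⟩
    refine hd (⟨x, hx⟩, ⟨y, hy⟩) ?_
    simpa using Set.ext_iff.1 hxy ⟨_, ha (⟨x, hx⟩, ⟨y, hy⟩)⟩

/-- If `κ` is inaccessible and families of subsets of `κ` whose small subfamilies have nonempty
intersections extend to `κ`-complete ultrafilters, then `κ` carries a non-Galvin ultrafilter. -/
theorem carriesNonGalvinUltrafilter_of_extension {κ : Cardinal.{u}} (hκ : κ.IsInaccessible)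
    (hext : ∀ B : Set (Set κ.ord.ToType), (∀ S ⊆ B, #S < κ → (⋂₀ S).Nonempty) →
      ∃ U : Ultrafilter κ.ord.ToType, CardinalInterFilter (U : Filter κ.ord.ToType) κ ∧
        ∀ s ∈ B, s ∈ U) :
    CarriesNonGalvinUltrafilter κ := by
  refine ⟨hκ.aleph0_lt, ?_⟩
  obtain ⟨A, hA⟩ := exists_independent_family hκ
  have hinj : Function.Injective A := fun y y' h => by
    by_contra hne
    have h1 : ∀ y : Set κ.ord.ToType, #({y} : Set (Set κ.ord.ToType)) < κ := fun y => by
      rw [mk_singleton]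
      exact one_lt_aleph0.trans hκ.aleph0_lt
    obtain ⟨p, hp, hp'⟩ := hA {y} {y'} (h1 _) (h1 _) (disjoint_singleton.2 hne)
    exact hp' y' rfl (h ▸ hp y rfl)
  obtain ⟨U, hU, hUB⟩ := hext (range A ∪ {X | ∃ I : Set (Set κ.ord.ToType), #I = κ ∧
      (⋂₀ (A '' I))ᶜ = X}) fun S hSB hS => by
    -- Since `S` has fewer than `κ` members, each complement in it includes the complement of some
    -- `A y` outside `S`. Independence then meets all demands at once. The index `∅` is a dummy.
    have hsel : ∀ X : S, ∃ y, X.1 ∉ range A → A y ∉ S ∧ (A y)ᶜ ⊆ X.1 := fun ⟨X, hX⟩ => by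
      by_cases hXA : X ∈ range A
      · exact ⟨∅, fun h => absurd hXA h⟩
      obtain ⟨I, hI, rfl⟩ := (hSB hX).resolve_left hXA
      obtain ⟨y, hy, hyS⟩ : ∃ y ∈ I, A y ∉ S := by
        by_contra! h
        refine hS.not_ge ?_
        exact (hI.symm.trans (mk_image_eq hinj).symm).trans_le
          (mk_le_mk_of_subset (image_subset_iff.2 h))
      exact ⟨y, fun _ => ⟨hyS, compl_subset_compl.2 (sInter_subset_of_mem (mem_image_of_mem A hy))⟩⟩
    choose f hf using hsel
    obtain ⟨p, hp, hp'⟩ := hA (A ⁻¹' S) (f '' {X | X.1 ∉ range A})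
      ((mk_preimage_of_injective _ _ hinj).trans_lt hS)
      ((mk_image_le.trans (mk_set_le _)).trans_lt hS) (by
        rw [disjoint_left]
        rintro y hy ⟨X, hX, rfl⟩
        exact (hf X hX).1 hy)
    refine ⟨p, fun X hX => ?_⟩
    by_cases hXA : X ∈ range A
    · obtain ⟨y, rfl⟩ := hXA
      exact hp y hX
    · exact (hf ⟨X, hX⟩ hXA).2 (hp' _ (mem_image_of_mem f hXA))
  refine ⟨U, hU, fun hG => ?_⟩
  obtain ⟨Y, hY⟩ : ∃ Y : Set (Set κ.ord.ToType), #Y = Order.succ κ := by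
    rw [← le_mk_iff_exists_set, mk_set, mk_ord_toType]
    exact Order.succ_le_of_lt (cantor κ)
  obtain ⟨B, hBA, hB, hBU⟩ := hG (A '' Y)
    (by
      rintro _ ⟨y, -, rfl⟩
      exact hUB _ (.inl (mem_range_self y)))
    ((mk_image_eq hinj).trans hY)
  obtain ⟨I, -, rfl⟩ := subset_image_iff.1 hBA
  refine (Ultrafilter.compl_mem_iff_notMem.1 (hUB _ (.inr ⟨I, ?_, rfl⟩))) hBU
  rwa [mk_image_eq hinj] at hB

/-! ### Reflection of non-Galvin ultrafilters below `κ`. -/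

/-- Relative to the class `C`, the set `μ` is not embeddable into `w` and carries an ultrafilter `U`
that is closed under intersections of families into which `μ` does not embed, with a family `A`
witnessing that `U` fails the Galvin property. -/
def HasNonGalvinUltrafilterIn (C : Set ZFSet.{u}) (μ w : ZFSet.{u}) : Prop :=
  ∃ U ∈ C, ∃ A ∈ C,
    (∀ X ∈ C, ∀ Y ∈ C, X ⊆ μ → Y ⊆ μ → (∀ t ∈ μ, (t ∈ X ↔ ¬ t ∈ Y)) → (X ∈ U ↔ ¬ Y ∈ U)) ∧
    (∀ X ∈ U, ∀ Y ∈ C, X ⊆ Y → Y ⊆ μ → Y ∈ U) ∧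
    (∀ S ∈ C, ∀ D ∈ C, (∀ X ∈ S, X ∈ U) → D ⊆ μ → (∀ t ∈ μ, (t ∈ D ↔ ∀ X ∈ S, t ∈ X)) →
      D ∈ U ∨ ∃ f ∈ C, f.IsInjRel μ S) ∧
    (∀ X ∈ A, X ∈ U ∧ X ⊆ μ) ∧
    (∀ f ∈ C, ¬ f.IsInjRel A μ) ∧
    (∀ S ∈ C, ∀ D ∈ C, ∀ f ∈ C, (∀ X ∈ S, X ∈ A) → D ⊆ μ →
      (∀ t ∈ μ, (t ∈ D ↔ ∀ X ∈ S, t ∈ X)) → f.IsInjRel μ S → ¬ D ∈ U) ∧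
    ∀ f ∈ C, ¬ f.IsInjRel μ w

/-- The parameter `v 1` will be `ω`, which `j` fixes. -/
theorem IsExpressible.exists_mem_hasNonGalvinUltrafilterIn :
    IsExpressible fun (C : Set ZFSet.{u}) (v : Fin 2 → ZFSet.{u}) =>
      ∃ μ ∈ v 0, HasNonGalvinUltrafilterIn C μ (v 1) := by
  unfold HasNonGalvinUltrafilterIn
  repeat' first
    | apply IsExpressible.all | apply IsExpressible.ex
    | apply IsExpressible.ball | apply IsExpressible.bex | apply IsExpressible.not
    | apply IsExpressible.isInjRel | apply IsExpressible.subset | apply IsExpressible.mem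
    | apply IsExpressible.and | apply IsExpressible.or | apply IsExpressible.imp
    | apply IsExpressible.iff

/-- A non-Galvin ultrafilter over the ordinal `β` in the sense of the universe is transferred to the
cardinality of `β`. -/
theorem carriesNonGalvinUltrafilter_card {β : Ordinal.{u}}
    (h : HasNonGalvinUltrafilterIn univ β.toZFSet (ℵ₀ : Cardinal.{u}).ord.toZFSet) :
    CarriesNonGalvinUltrafilter β.card := by
  obtain ⟨U, -, A, -, hcompl, hmono, hinter, hAU, hA, hnG, hω⟩ := h
  set c := β.card with hc
  -- Reflection yields an ordinal `β`, not necessarily a cardinal; the ultrafilter is moved along a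
  -- bijection.
  obtain ⟨φ⟩ : Nonempty (c.ord.ToType ≃ β.ToType) := Cardinal.eq.1 (by simp [hc])
  have hcard : #c.ord.ToType = c := mk_ord_toType c
  set enc := β.enc ∘ φ
  have henc : Function.Injective enc := (Ordinal.enc_injective _).comp φ.injective
  have hk : ∀ z, z ∈ β.toZFSet ↔ ∃ a, enc a = z := fun z => by
    rw [Ordinal.mem_toZFSet_iff_exists_enc, φ.surjective.exists]
    rfl
  set E := ZFSet.encSet enc
  have hE : ∀ {a s}, enc a ∈ E s ↔ a ∈ s := ZFSet.apply_mem_encSet henc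
  have hEinj : Function.Injective E := ZFSet.encSet_injective henc
  have hEk : ∀ s, E s ⊆ β.toZFSet := ZFSet.encSet_subset hk
  have hcc : ℵ₀ < c := by
    by_contra! hle
    obtain ⟨g, hg⟩ := ZFSet.exists_isInjRel (Ordinal.enc_injective _)
      (fun z hz => (hk z).1 hz) (fun y => Ordinal.mem_toZFSet_iff_exists_enc.2 ⟨y, rfl⟩)
      (by rwa [hcard, mk_ord_toType] : #c.ord.ToType ≤ #(ℵ₀ : Cardinal.{u}).ord.ToType)
    exact hω _ (mem_univ _) hg
  have hEinter : ∀ S : Set (Set c.ord.ToType), ∀ t ∈ β.toZFSet,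
      (t ∈ E (⋂₀ S) ↔ ∀ X ∈ ZFSet.range fun s : S => E s, t ∈ X) := fun S t ht => by
    obtain ⟨a, rfl⟩ := (hk t).1 ht
    rw [hE]
    simp [hE]
  have hcomplete : ∀ S : Set (Set c.ord.ToType), #S < c → (∀ s ∈ S, E s ∈ U) → E (⋂₀ S) ∈ U :=
    fun S hS hSU => by
    obtain h | ⟨f, -, hf⟩ := hinter (ZFSet.range fun s : S => E s) (mem_univ _) (E (⋂₀ S))
      (mem_univ _) (by simpa using hSU) (hEk _) (hEinter S)
    · exact h
    · have := hf.mk_le henc (fun x => (hk _).2 ⟨x, rfl⟩) (fun z hz => ZFSet.mem_range.1 hz)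
      rw [hcard] at this
      exact absurd hS this.not_gt
  let F : Filter c.ord.ToType :=
    { sets := {s | E s ∈ U}
      univ_sets := by
        rw [← sInter_empty]
        exact hcomplete ∅ (by simpa using aleph0_pos.trans hcc) (by simp)
      sets_of_superset := fun {s t} hs hst => hmono _ hs _ (mem_univ _) (fun z hz => by
        obtain ⟨a, ha, rfl⟩ := ZFSet.mem_encSet.1 hz
        exact hE.2 (hst ha)) (hEk _)
      inter_sets := fun {s t} hs ht => by
        rw [Set.mem_ofPred_eq, ← sInter_pair]
        refine hcomplete _ (lt_trans (Cardinal.lt_aleph0_of_finite _) hcc) ?_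
        rintro r (rfl | rfl) <;> assumption }
  refine ⟨hcc, Ultrafilter.ofComplNotMemIff F fun s => ?_, ⟨hcomplete⟩, fun hG => ?_⟩
  · refine (hcompl _ (mem_univ _) _ (mem_univ _) (hEk _) (hEk _) fun t ht => ?_).symm
    obtain ⟨a, rfl⟩ := (hk t).1 ht
    rw [hE, hE, mem_compl_iff, not_not]
  · have hAc : Order.succ c ≤ #{s | E s ∈ A} := by
      rw [Order.succ_le_iff]
      by_contra! hle
      obtain ⟨g, hg⟩ := ZFSet.exists_isInjRel (a := fun s : {s | E s ∈ A} => E s) henc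
        (fun z hz => ⟨⟨{a | enc a ∈ z}, by
            have h := ZFSet.eq_encSet hk (hAU z hz).2
            exact (congrArg (· ∈ A) h).mp hz⟩, (ZFSet.eq_encSet hk (hAU z hz).2).symm⟩)
        (fun y => (hk _).2 ⟨y, rfl⟩) (hle.trans_eq hcard.symm)
      exact hA _ (mem_univ _) hg
    -- The Galvin property speaks of exactly `c⁺` sets, so the family is thinned out.
    obtain ⟨A', hA', hA'c⟩ := le_mk_iff_exists_subset.1 hAc
    obtain ⟨B, hBA, hB, hBU⟩ := hG A' (fun s hs => show E s ∈ U from (hAU _ (hA' hs)).1) hA'c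
    obtain ⟨g, hg⟩ := ZFSet.exists_isInjRel (B := ZFSet.range fun s : B => E s)
      (hEinj.comp Subtype.val_injective)
      (fun z hz => (hk z).1 hz) (fun y : B => by simp) (hcard.trans hB.symm).le
    refine hnG (ZFSet.range fun s : B => E s) (mem_univ _) (E (⋂₀ B)) (mem_univ _) _ (mem_univ _)
      (fun X hX => ?_) (hEk _) (hEinter B) hg hBU
    obtain ⟨s, rfl⟩ := ZFSet.mem_range.1 hX
    exact hA' (hBA s.2)

section Embedding

variable {M : Set ZFSet.{u}} (hM : IsTransitiveClass M) (j : ZFSet.{u} ↪ₑ[setLanguage] M)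
  {κ : Cardinal.{u}} (hκ : IsCriticalPoint j κ.ord)
include hM hκ

/-- A class closed under `2 ^ κ`-sequences knows the non-Galvin ultrafilters over `κ`. -/
theorem hasNonGalvinUltrafilterIn_of_carries {lam : Cardinal.{u}}
    (hcl : ClosedUnderSequences M lam) (hlam : 2 ^ κ ≤ lam) (h : CarriesNonGalvinUltrafilter κ) :
    HasNonGalvinUltrafilterIn M κ.ord.toZFSet (ℵ₀ : Cardinal.{u}).ord.toZFSet := by
  obtain ⟨hω, U, hU, hG⟩ := h
  simp only [HasGalvinProperty] at hG
  push Not at hG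
  obtain ⟨A, hAU, hA, hAG⟩ := hG
  have hcard : #κ.ord.ToType = κ := mk_ord_toType κ
  have hk : ∀ z, z ∈ κ.ord.toZFSet ↔ ∃ a, κ.ord.enc a = z := fun _ =>
    Ordinal.mem_toZFSet_iff_exists_enc
  set E := ZFSet.encSet κ.ord.enc with hE_def
  have hE : ∀ {a s}, κ.ord.enc a ∈ E s ↔ a ∈ s := ZFSet.apply_mem_encSet (Ordinal.enc_injective _)
  have hEinj : Function.Injective E := ZFSet.encSet_injective (Ordinal.enc_injective _)
  have hEk : ∀ s, E s ⊆ κ.ord.toZFSet := ZFSet.encSet_subset hk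
  have hEM : ∀ s, E s ∈ M := fun s =>
    range_mem_class hM j hcl _ (fun a => enc_mem_class j hκ _)
      (((mk_set_le s).trans_eq hcard).trans ((cantor κ).le.trans hlam))
  have hfam : ∀ B : Set (Set κ.ord.ToType), (ZFSet.range fun s : B => E s) ∈ M := fun B =>
    range_mem_class hM j hcl _ (fun s => hEM s) ((mk_set_le B).trans (by rwa [mk_set, hcard]))
  have hrange : ∀ (B : Set (Set κ.ord.ToType)) s, E s ∈ (ZFSet.range fun s : B => E s) ↔ s ∈ B :=
    fun B s => by simp [hEinj.eq_iff]
  have hsub : ∀ X ⊆ κ.ord.toZFSet, ∃ s, X = E s := fun X hX => ⟨_, ZFSet.eq_encSet hk hX⟩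
  have hmem : ∀ {B : Set (Set κ.ord.ToType)} {X}, X ∈ (ZFSet.range fun s : B => E s) →
      ∃ s ∈ B, X = E s := fun {B X} hX => by
    obtain ⟨s, rfl⟩ := ZFSet.mem_range.1 hX
    exact ⟨s, s.2, rfl⟩
  refine ⟨_, hfam {s | s ∈ U}, _, hfam A, fun X _ Y _ hX hY hXY => ?_, fun X hX Y _ hXY hY => ?_,
    fun S hS D _ hSU hD hDS => ?_, fun X hX => ?_, fun f _ hf => ?_,
    fun S _ D _ f _ hSA hD hDS hf hDU => ?_, fun f _ hf => ?_⟩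
  · obtain ⟨s, rfl⟩ := hsub X hX
    obtain ⟨t, rfl⟩ := hsub Y hY
    rw [hrange, hrange]
    obtain rfl : s = tᶜ := by
      ext a
      have := hXY _ ((hk _).2 ⟨a, rfl⟩)
      rwa [hE, hE] at this
    exact Ultrafilter.compl_mem_iff_notMem
  · obtain ⟨s, hs, rfl⟩ := hmem hX
    obtain ⟨t, rfl⟩ := hsub Y hY
    rw [hrange]
    exact Filter.mem_of_superset hs fun a ha => hE.1 (hXY (hE.2 ha))
  · obtain ⟨d, rfl⟩ := hsub D hD
    rw [hrange]
    rcases lt_or_ge #{s | E s ∈ S} κ with hlt | hle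
    · refine .inl (Filter.mem_of_superset (hU.cardinal_sInter_mem {s | E s ∈ S} hlt
        fun s hs => (hrange _ _).1 (hSU _ hs)) fun a ha => ?_)
      refine hE.1 ((hDS _ ((hk _).2 ⟨a, rfl⟩)).2 fun X hX => ?_)
      obtain ⟨s, -, rfl⟩ := hmem (hSU X hX)
      exact hE.2 (ha s hX)
    · obtain ⟨g, hg⟩ := ZFSet.exists_isInjRel (B := S) (b := fun s : {s | E s ∈ S} => E s)
        (hEinj.comp Subtype.val_injective)
        (fun z hz => (hk z).1 hz) (fun s => s.2) (hcard.trans_le hle)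
      -- This clause asks for an injection inside `M`; its graph has only `κ` pairs, so closure
      -- provides it.
      exact .inr ⟨_, range_mem_class hM j hcl _
        (fun a => pair_mem_class hM j (enc_mem_class j hκ _) (hEM _))
        (hcard.trans_le ((cantor κ).le.trans hlam)), hg⟩
  · obtain ⟨s, hs, rfl⟩ := hmem hX
    exact ⟨(hrange _ _).2 (hAU s hs), hEk s⟩
  · have := hf.mk_le (hEinj.comp Subtype.val_injective) (fun s : A => (hrange A s).2 s.2)
      fun z hz => (hk z).1 hz
    rw [hA, hcard] at this
    exact this.not_gt (Order.lt_succ κ)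
  · obtain ⟨d, rfl⟩ := hsub D hD
    have hle := hf.mk_le (b := fun s : {s | E s ∈ S} => E s) (Ordinal.enc_injective _)
      (fun a => (hk _).2 ⟨a, rfl⟩) fun z hz => by
        obtain ⟨s, -, rfl⟩ := hmem (hSA z hz)
        exact ⟨⟨s, hz⟩, rfl⟩
    rw [hcard] at hle
    obtain ⟨B, hBS, hB⟩ := le_mk_iff_exists_subset.1 hle
    refine hAG B (fun s hs => (hrange _ _).1 (hSA _ (hBS hs))) hB
      (Filter.mem_of_superset ((hrange _ _).1 hDU) fun a ha s hs => ?_)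
    exact hE.1 ((hDS _ ((hk _).2 ⟨a, rfl⟩)).1 (hE.2 ha) _ (hBS hs))
  · have := hf.mk_le (Ordinal.enc_injective _) (fun a => (hk _).2 ⟨a, rfl⟩)
      (fun z hz => Ordinal.mem_toZFSet_iff_exists_enc.1 hz)
    rw [hcard, mk_ord_toType] at this
    exact this.not_gt hω

end Embedding

theorem IsSupercompactUpTo.exists_carriesNonGalvinUltrafilter {κ : Cardinal.{u}}
    (h : IsSupercompactUpTo κ (2 ^ κ)) : ∃ μ < κ, CarriesNonGalvinUltrafilter μ := by
  obtain ⟨M, j, hM, hκ, hcl⟩ := h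
  have hκ' := isInaccessible_of_isCriticalPoint hM j hκ
  have hcarry : CarriesNonGalvinUltrafilter κ :=
    carriesNonGalvinUltrafilter_of_extension hκ' (exists_ultrafilter_superset hM j hκ hcl le_rfl)
  -- In `M` the element `κ` of `j κ` is a witness.
  obtain ⟨μ, hμ, hμU⟩ := (elementary_iff hM j
    IsExpressible.exists_mem_hasNonGalvinUltrafilterIn
    ![κ.ord.toZFSet, (ℵ₀ : Cardinal.{u}).ord.toZFSet]).2
    ⟨κ.ord.toZFSet, ord_mem_embedding hM j hκ, by
      change HasNonGalvinUltrafilterIn M _ (j (ℵ₀ : Cardinal.{u}).ord.toZFSet : ZFSet.{u})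
      rw [embedding_ord_of_lt j hκ (Cardinal.ord_lt_ord.2 hκ'.aleph0_lt)]
      exact hasNonGalvinUltrafilterIn_of_carries hM j hκ hcl le_rfl hcarry⟩
  obtain ⟨β, hβ, rfl⟩ := Ordinal.mem_toZFSet_iff.1 hμ
  exact ⟨β.card, Cardinal.lt_ord.1 hβ, carriesNonGalvinUltrafilter_card hμU⟩

theorem mainTheorem11 (κ : Cardinal.{u})
    (hκ : IsLeast {ν : Cardinal.{u} | IsSupercompact ν} κ) :
    ∃ μ : Cardinal.{u},
      IsLeast {ν : Cardinal.{u} | CarriesNonGalvinUltrafilter ν} μ ∧ μ < κ := by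
  obtain ⟨μ, hμ, hμU⟩ :=
    (hκ.1 (2 ^ κ) (cantor κ).le).exists_carriesNonGalvinUltrafilter
  have hne : {ν : Cardinal.{u} | CarriesNonGalvinUltrafilter ν}.Nonempty := ⟨μ, hμU⟩
  exact ⟨sInf _, ⟨csInf_mem hne, fun ν hν => csInf_le' hν⟩,
    (csInf_le' (s := {ν | CarriesNonGalvinUltrafilter ν}) hμU).trans_lt hμ⟩
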